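/- Let $k$ be an algebraically closed field of characteristic zero. Let $(l_{ij})$ be a symmetric $4\times 4$ matrix of linear forms in $k[z_0,z_1,z_2,z_3]$ such that $$\det(l_{ij})=\alpha z_3^2+\beta z_3+\gamma,$$ where $\alpha,\beta,\gamma\in k[z_0,z_1,z_2]$ are forms of degrees $2,3,4$, and let $\epsilon_1,\epsilon_2\in k[z_0,z_1,z_2]$ be cubic forms with $\beta^2-4\alpha\gamma=\epsilon_1\epsilon_2$. Put $A=\{\alpha=0\}$ and $E_i=\{\epsilon_i=0\}$ in $\mathbb{P}^2$. Suppose that the quartic symmetroid is general in the following sense: the surface $\{\det(l_{ij})=0\}\subseteq\mathbb{P}^3$ has exactly $10$ singular points, all of them isolated nodes; the cubics $E_1,E_2$ are smooth and meet transversely in $9$ points; the conic $A$ is smooth, meets each $E_i$ in exactly $3$ points and is tangent to $E_i$ at these; and $A\cap E_1\cap E_2=\emptyset$. Let $\delta\in k[z_0,z_1,z_2]$ be a quadratic form such that the conic $D=\{\delta=0\}$ is smooth, meets each of $E_1$, $E_2$ and $A$ transversely, and satisfies $D\cap E_1\cap E_2=\emptyset$. Let $V\subseteq\mathbb{P}^4$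 be the quartic threefold defined by $$h=\alpha z_3^2+\beta z_3+\gamma+\delta z_4^2 .$$ Then: (i) $V$ is singular at every point of the line $L=\{z_0=z_1=z_2=0\}\subseteq\mathbb{P}^4$; (ii) there are exactly $9$ further singular points of $V$ not contained in $L$, and each of them is an isolated node ($A_1$-singularity) of $V$; (iii) $V$ has no other singular points. -/

import Mathlib

open MvPolynomial
open scoped LinearAlgebra.Projectivization

namespace QuarticThreefold

section Hypersurfaces

variable {k : Type*} [Field k] {n : ℕ}

/-- The hypersurface `V(f)` in projective `n`-space of a form `f`, as a set of `k`-points.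
Only used for homogeneous `f`, where the choice of the representative is irrelevant. -/
def zeroLocus (f : MvPolynomial (Fin (n + 1)) k) : Set (ℙ k (Fin (n + 1) → k)) :=
  {p | eval p.rep f = 0}

/-- The gradient of a form at (the chosen representative of) a point. -/
noncomputable def gradient (f : MvPolynomial (Fin (n + 1)) k) (p : ℙ k (Fin (n + 1) → k)) :
    Fin (n + 1) → k :=
  fun i => eval p.rep (pderiv i f)

/-- The singular points of the hypersurface `V(f)` (Jacobian criterion). -/
def singularLocus (f : MvPolynomial (Fin (n + 1)) k) : Set (ℙ k (Fin (n + 1) → k)) :=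
  {p | p ∈ zeroLocus f ∧ gradient f p = 0}

/-- `V(f)` is smooth. -/
def IsSmooth (f : MvPolynomial (Fin (n + 1)) k) : Prop :=
  singularLocus f = ∅

/-- `p` is an isolated point of the singular locus of `V(f)`: some basic Zariski open
neighbourhood `{g ≠ 0}` of `p` contains no other singular point. -/
def IsIsolatedSingularity (f : MvPolynomial (Fin (n + 1)) k) (p : ℙ k (Fin (n + 1) → k)) :
    Prop :=
  p ∈ singularLocus f ∧
    ∃ (d : ℕ) (g : MvPolynomial (Fin (n + 1)) k), g.IsHomogeneous d ∧ p ∉ zeroLocus g ∧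
      ∀ q ∈ singularLocus f, q ∉ zeroLocus g → q = p

/-- The local equation of `V(f)` at `p` in the affine chart `{z_i ≠ 0}`: put `z_i = 1` and
translate `p` to the origin.  The affine coordinates `z_j / z_i` with `j ≠ i` are numbered
by `Fin n` through `i.succAbove`. -/
noncomputable def localEquation (f : MvPolynomial (Fin (n + 1)) k)
    (p : ℙ k (Fin (n + 1) → k)) (i : Fin (n + 1)) : MvPolynomial (Fin n) k :=
  aeval (i.insertNth (α := fun _ => MvPolynomial (Fin n) k) 1
    (fun j => X j + C (p.rep (i.succAbove j) / p.rep i))) f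

/-- `p` is a node (`A₁` point, ordinary double point) of `V(f)`: in an affine chart around `p`,
the local equation has no constant and no linear term, and its quadratic part is nondegenerate,
that is, the Hessian matrix at the origin is invertible (the characteristic is not two here). -/
def IsNode (f : MvPolynomial (Fin (n + 1)) k) (p : ℙ k (Fin (n + 1) → k)) : Prop :=
  ∃ i : Fin (n + 1), p.rep i ≠ 0 ∧
    eval 0 (localEquation f p i) = 0 ∧
    (∀ a, eval 0 (pderiv a (localEquation f p i)) = 0) ∧
    (Matrix.of fun a b : Fin n =>
      eval 0 (pderiv a (pderiv b (localEquation f p i)))).det ≠ 0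

/-- `V(f)` and `V(g)` meet transversely: their gradients are linearly independent at every
common point. -/
def MeetTransversely (f g : MvPolynomial (Fin (n + 1)) k) : Prop :=
  ∀ p ∈ zeroLocus f ∩ zeroLocus g, LinearIndependent k ![gradient f p, gradient g p]

/-- `V(f)` and `V(g)` are tangent at every common point, and have exactly `m` common points. -/
def TangentAtPoints (f g : MvPolynomial (Fin (n + 1)) k) (m : ℕ) : Prop :=
  (zeroLocus f ∩ zeroLocus g).ncard = m ∧
    ∀ p ∈ zeroLocus f ∩ zeroLocus g, ¬ LinearIndependent k ![gradient f p, gradient g p]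

end Hypersurfaces

section Construction

variable {k : Type*} [Field k]

/-- A symmetric `4 × 4` matrix of linear forms in `z₀, z₁, z₂, z₃`.  Its determinant is the
equation of a quartic symmetroid. -/
def IsSymmetroidMatrix (l : Matrix (Fin 4) (Fin 4) (MvPolynomial (Fin 4) k)) : Prop :=
  l.IsSymm ∧ ∀ i j, (l i j).IsHomogeneous 1

/-- The conditions imposed on the quartic symmetroid `det l = α z₃² + β z₃ + γ`, with the
factorization `ε₁ ε₂` of the discriminant.  The equation has degree two in `z₃` and
nonzero discriminant, so the projection from the singular point `(0:0:0:1)` is a double covering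
of the plane ramified along the sextic `{ε₁ ε₂ = 0}`. -/
structure IsGeneralSymmetroid (l : Matrix (Fin 4) (Fin 4) (MvPolynomial (Fin 4) k))
    (α β γ ε₁ ε₂ : MvPolynomial (Fin 3) k) : Prop where
  matrix : IsSymmetroidMatrix l
  homogeneous_α : α.IsHomogeneous 2
  homogeneous_β : β.IsHomogeneous 3
  homogeneous_γ : γ.IsHomogeneous 4
  homogeneous_ε₁ : ε₁.IsHomogeneous 3
  homogeneous_ε₂ : ε₂.IsHomogeneous 3
  /-- the equation of the symmetroid, the centre of projection being `(0:0:0:1)` -/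
  det_eq : l.det =
    rename ![0, 1, 2] α * X 3 ^ 2 + rename ![0, 1, 2] β * X 3 + rename ![0, 1, 2] γ
  /-- the symmetroid has exactly ten singular points, and they are isolated nodes -/
  ten_singular : (singularLocus l.det).ncard = 10
  nodes : ∀ p ∈ singularLocus l.det, IsIsolatedSingularity l.det p ∧ IsNode l.det p
  /-- the branch sextic is the union of the two cubics `E₁` and `E₂` -/
  discriminant : β ^ 2 - 4 * α * γ = ε₁ * ε₂
  /-- the two cubics are smooth and meet transversely at nine points -/
  smooth_ε₁ : IsSmooth ε₁
  smooth_ε₂ : IsSmooth ε₂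
  transverse : MeetTransversely ε₁ ε₂
  nine_points : (zeroLocus ε₁ ∩ zeroLocus ε₂).ncard = 9
  /-- the conic `A = {α = 0}` is smooth and tangent to each cubic at three points -/
  smooth_α : IsSmooth α
  tangent_ε₁ : TangentAtPoints α ε₁ 3
  tangent_ε₂ : TangentAtPoints α ε₂ 3
  /-- the conic `A` does not meet `E₁ ∩ E₂` -/
  disjoint : zeroLocus α ∩ (zeroLocus ε₁ ∩ zeroLocus ε₂) = ∅

/-- The conditions imposed on the auxiliary conic `D = {δ = 0}`. -/
structure IsGeneralConic (α ε₁ ε₂ δ : MvPolynomial (Fin 3) k) : Prop where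
  homogeneous : δ.IsHomogeneous 2
  smooth : IsSmooth δ
  transverse_ε₁ : MeetTransversely δ ε₁
  transverse_ε₂ : MeetTransversely δ ε₂
  transverse_α : MeetTransversely δ α
  disjoint : zeroLocus δ ∩ (zeroLocus ε₁ ∩ zeroLocus ε₂) = ∅

/-- The equation `h = α z₃² + β z₃ + γ + δ z₄²` of the quartic threefold in `ℙ⁴`. -/
noncomputable def threefoldEquation (α β γ δ : MvPolynomial (Fin 3) k) :
    MvPolynomial (Fin 5) k :=
  rename ![0, 1, 2] α * X 3 ^ 2 + rename ![0, 1, 2] β * X 3 + rename ![0, 1, 2] γ +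
    rename ![0, 1, 2] δ * X 4 ^ 2

/-- The line `L = {z₀ = z₁ = z₂ = 0}` in `ℙ⁴`. -/
def lineL (k : Type*) [Field k] : Set (ℙ k (Fin 5 → k)) :=
  {p | p.rep 0 = 0 ∧ p.rep 1 = 0 ∧ p.rep 2 = 0}

end Construction

end QuarticThreefold

namespace QuarticThreefold

/-! ### Homogeneous forms and representatives of projective points -/

section Representatives

variable {k : Type*} [Field k] {n d : ℕ}

/-! The derivative of `h` in `z₄` is `2 δ z₄`, so a singular point has `δ = 0` or `z₄ = 0`. Off `L`
the first case cannot occur (`eval_delta_ne_zero`). The point lies over some `u` in the plane where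
`α z² + β z + γ` has a multiple zero, so `ε₁ ε₂` vanishes at `u`, and differentiating the
discriminant makes the gradient of `ε₁ ε₂` at `u` a multiple of that of `δ`. Transversality of `D`
to the cubics then forces `u` into `D ∩ E₁ ∩ E₂`, which is empty.

Hence all singular points off `L` lie in the hyperplane `z₄ = 0`. There `δ z₄²` vanishes to second
order, so they are singular points of the symmetroid (`hyperplaneMap_mem_singularLocus`). Of its ten
nodes exactly one, `(0:0:0:1)`, lies on `L`. The other nine remain nodes because `δ z₄²` with `δ ≠
0` adds a nondegenerate square to the local quadratic part (`IsNode.extend`). -/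

theorem eval_smul {σ : Type*} {f : MvPolynomial σ k} (hf : f.IsHomogeneous d) (a : k) (v : σ → k) :
    eval (a • v) f = a ^ d * eval v f := by
  rw [eval_eq, eval_eq, Finset.mul_sum]
  refine Finset.sum_congr rfl fun m hm => ?_
  have hd : m.degree = d := by
    rw [Finsupp.degree_eq_weight_one]
    exact hf (mem_support_iff.1 hm)
  simp only [Pi.smul_apply, smul_eq_mul, mul_pow, Finset.prod_mul_distrib]
  rw [Finset.prod_pow_eq_pow_sum, show ∑ i ∈ m.support, m i = d from hd]
  ring

theorem eval_pderiv_smul {σ : Type*} {f : MvPolynomial σ k} (hf : f.IsHomogeneous d)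
    (a : k) (v : σ → k) (i : σ) :
    eval (a • v) (pderiv i f) = a ^ (d - 1) * eval v (pderiv i f) :=
  eval_smul hf.pderiv a v

theorem exists_rep_mk {v : Fin (n + 1) → k} (hv : v ≠ 0) :
    ∃ a : k, a ≠ 0 ∧ (Projectivization.mk k v hv).rep = a • v := by
  obtain ⟨a, ha⟩ := Projectivization.exists_smul_eq_mk_rep k v hv
  exact ⟨a, a.ne_zero, ha.symm⟩

theorem mk_mem_zeroLocus {f : MvPolynomial (Fin (n + 1)) k} (hf : f.IsHomogeneous d)
    {v : Fin (n + 1) → k} (hv : v ≠ 0) :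
    Projectivization.mk k v hv ∈ zeroLocus f ↔ eval v f = 0 := by
  obtain ⟨a, ha, h⟩ := exists_rep_mk hv
  simp [zeroLocus, h, eval_smul hf, ha]

theorem mk_mem_singularLocus {f : MvPolynomial (Fin (n + 1)) k} (hf : f.IsHomogeneous d)
    {v : Fin (n + 1) → k} (hv : v ≠ 0) :
    Projectivization.mk k v hv ∈ singularLocus f ↔
      eval v f = 0 ∧ ∀ i, eval v (pderiv i f) = 0 := by
  obtain ⟨a, ha, h⟩ := exists_rep_mk hv
  rw [singularLocus, Set.mem_ofPred_eq, mk_mem_zeroLocus hf, funext_iff]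
  simp [gradient, h, eval_pderiv_smul hf, ha]

theorem mem_singularLocus {f : MvPolynomial (Fin (n + 1)) k} {p : ℙ k (Fin (n + 1) → k)} :
    p ∈ singularLocus f ↔ eval p.rep f = 0 ∧ ∀ i, eval p.rep (pderiv i f) = 0 := by
  simp [singularLocus, zeroLocus, gradient, funext_iff]

theorem MeetTransversely.eq_zero {f g : MvPolynomial (Fin (n + 1)) k} {e : ℕ}
    (h : MeetTransversely f g) (hf : f.IsHomogeneous d) (hg : g.IsHomogeneous e)
    {v : Fin (n + 1) → k} (hv : v ≠ 0) (hfv : eval v f = 0) (hgv : eval v g = 0) {s t : k}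
    (hst : ∀ i, s * eval v (pderiv i f) + t * eval v (pderiv i g) = 0) : t = 0 := by
  obtain ⟨a, ha, hr⟩ := exists_rep_mk hv
  have hli := h _ ⟨(mk_mem_zeroLocus hf hv).2 hfv, (mk_mem_zeroLocus hg hv).2 hgv⟩
  rw [LinearIndependent.pair_iff] at hli
  -- The two gradients at the representative `a • v` are scaled by `a ^ (d - 1)` and `a ^ (e - 1)`;
  -- the crossed factors restore a common multiple of the relation at `v`.
  have := (hli (a ^ (e - 1) * s) (a ^ (d - 1) * t) ?_).2
  · simpa [ha] using this
  · ext i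
    simp only [gradient, hr, Pi.add_apply, Pi.smul_apply, smul_eq_mul, Pi.zero_apply,
      eval_pderiv_smul hf, eval_pderiv_smul hg]
    linear_combination a ^ (e - 1) * a ^ (d - 1) * hst i

end Representatives

/-! ### The discriminant argument in the plane -/

section Plane

variable {k : Type*} [Field k]

/-- The discriminant argument: at a point of the plane under a singular point of the threefold
outside `L`, with `c = z₄²`, the form `δ` does not vanish. -/
theorem eval_delta_ne_zero {α β γ ε₁ ε₂ δ : MvPolynomial (Fin 3) k}
    (hε₁ : ε₁.IsHomogeneous 3) (hε₂ : ε₂.IsHomogeneous 3)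
    (hdisc : β ^ 2 - 4 * α * γ = ε₁ * ε₂) (hδ : IsGeneralConic α ε₁ ε₂ δ)
    {u : Fin 3 → k} (hu : u ≠ 0) {z c : k}
    (h0 : eval u α * z ^ 2 + eval u β * z + eval u γ = 0)
    (h1 : 2 * eval u α * z + eval u β = 0)
    (h2 : ∀ i, eval u (pderiv i α) * z ^ 2 + eval u (pderiv i β) * z + eval u (pderiv i γ) +
      c * eval u (pderiv i δ) = 0) : eval u δ ≠ 0 := by
  intro hδu
  have hprod : eval u ε₁ * eval u ε₂ = 0 := by
    have := congrArg (eval u) hdisc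
    simp only [map_sub, map_pow, map_mul, map_ofNat] at this
    rw [← this]
    -- Completing the square: `β² - 4αγ = (2αz + β)² - 4α(αz² + βz + γ)`.
    linear_combination (2 * eval u α * z + eval u β) * h1 - 4 * eval u α * h0
  have hgrad : ∀ i, eval u ε₁ * eval u (pderiv i ε₂) + eval u ε₂ * eval u (pderiv i ε₁) =
      4 * eval u α * c * eval u (pderiv i δ) := by
    intro i
    have h4 : pderiv i (4 : MvPolynomial (Fin 3) k) = 0 :=
      pderiv_C (R := k) (a := 4)
    have := congrArg (fun f => eval u (pderiv i f)) hdisc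
    simp only [map_sub, pderiv_mul, pderiv_pow, map_add, map_mul, map_ofNat, h4, map_pow,
      map_natCast, map_zero] at this
    norm_num at this
    -- By `h1`, `β = -2αz`, and then by `h0`, `γ = αz²`; the derivative of the discriminant becomes
    -- `-4α(z² ∂α + z ∂β + ∂γ)`, which `h2` turns into `4αc ∂δ`.
    linear_combination -this + 2 * eval u (pderiv i β) * h1 - 4 * eval u α * h2 i
      - 4 * eval u (pderiv i α) * h0 + 4 * z * eval u (pderiv i α) * h1
  have hdisj : ¬ (eval u ε₁ = 0 ∧ eval u ε₂ = 0) := by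
    rintro ⟨h₁, h₂⟩
    have : Projectivization.mk k u hu ∈ zeroLocus δ ∩ (zeroLocus ε₁ ∩ zeroLocus ε₂) :=
      ⟨(mk_mem_zeroLocus hδ.homogeneous hu).2 hδu, (mk_mem_zeroLocus hε₁ hu).2 h₁,
        (mk_mem_zeroLocus hε₂ hu).2 h₂⟩
    rw [hδ.disjoint] at this
    exact this
  rcases mul_eq_zero.1 hprod with h | h
  -- With `ε₁ = 0`, `hgrad` is a linear relation between the gradients of `δ` and `ε₁` in which the
  -- latter has coefficient `ε₂`; so `ε₂ = 0` too.
  · refine hdisj ⟨h, hδ.transverse_ε₁.eq_zero hδ.homogeneous hε₁ hu hδu h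
      (s := -(4 * eval u α * c)) fun i => ?_⟩
    linear_combination hgrad i - eval u (pderiv i ε₂) * h
  · refine hdisj ⟨hδ.transverse_ε₂.eq_zero hδ.homogeneous hε₂ hu hδu h
      (s := -(4 * eval u α * c)) fun i => ?_, h⟩
    linear_combination hgrad i - eval u (pderiv i ε₁) * h

end Plane
-- Adding the square of a new variable to an equation with a node
section Extension

variable {k : Type*} [Field k] {n : ℕ}

theorem pderiv_rename_of_notMem_range {σ τ : Type*} {f : σ → τ} {j : τ} (hj : j ∉ Set.range f)
    (p : MvPolynomial σ k) : pderiv j (rename f p) = 0 := by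
  classical
  refine pderiv_eq_zero_of_notMem_vars fun h => hj ?_
  have := vars_rename f p h
  obtain ⟨i, -, rfl⟩ := Finset.mem_image.1 this
  exact ⟨i, rfl⟩

/-- Extension of a vector by a last coordinate zero. -/
def extendZero (k : Type*) [Field k] (n : ℕ) : (Fin n → k) →ₗ[k] (Fin (n + 1) → k) where
  toFun v := Fin.snoc (α := fun _ => k) v 0
  map_add' v w := by
    ext i
    refine Fin.lastCases ?_ (fun j => ?_) i <;> simp
  map_smul' a v := by
    ext i
    refine Fin.lastCases ?_ (fun j => ?_) i <;> simp

@[simp] theorem extendZero_castSucc (v : Fin n → k) (i : Fin n) :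
    extendZero k n v i.castSucc = v i := by simp [extendZero]

@[simp] theorem extendZero_last (v : Fin n → k) : extendZero k n v (Fin.last n) = 0 := by
  simp [extendZero]

theorem extendZero_comp_castSucc (v : Fin n → k) : extendZero k n v ∘ Fin.castSucc = v :=
  funext fun i => extendZero_castSucc v i

theorem extendZero_injective : Function.Injective (extendZero k n) := fun v w h => by
  rw [← extendZero_comp_castSucc v, h, extendZero_comp_castSucc]

theorem det_of_last_row_eq_zero (M : Matrix (Fin (n + 1)) (Fin (n + 1)) k)
    (h : ∀ j : Fin n, M (Fin.last n) j.castSucc = 0) :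
    M.det = M (Fin.last n) (Fin.last n) * (M.submatrix Fin.castSucc Fin.castSucc).det := by
  rw [Matrix.det_succ_row M (Fin.last n), Fin.sum_univ_castSucc]
  simp [h, ← two_mul]

/-- Adding the square of a new variable, with a coefficient which does not vanish at the point,
to the equation of a hypersurface with a node gives a hypersurface with a node. -/
theorem IsNode.extend [CharZero k] {F : MvPolynomial (Fin (n + 1)) k}
    {D : MvPolynomial (Fin (n + 2)) k} {d : ℕ} (hD : D.IsHomogeneous d)
    {p : ℙ k (Fin (n + 1) → k)} {q : ℙ k (Fin (n + 2) → k)} {a : k} (ha : a ≠ 0)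
    (hq : q.rep = a • extendZero k (n + 1) p.rep) (hDq : eval q.rep D ≠ 0) (hp : IsNode F p) :
    IsNode (rename Fin.castSucc F + D * X (Fin.last (n + 1)) ^ 2) q := by
  obtain ⟨i, hi, h0, h1, h2⟩ := hp
  have hqi : q.rep i.castSucc = a * p.rep i := by simp [hq]
  have hqi0 : q.rep i.castSucc ≠ 0 := by rw [hqi]; exact mul_ne_zero ha hi
  set G := localEquation F p i with hG
  set E := localEquation D q i.castSucc with hE
  -- The last coordinate of `q` is zero, so the new variable is not translated; in the other affine
  -- coordinates the factor `a` cancels.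
  have hloc : localEquation (rename Fin.castSucc F + D * X (Fin.last (n + 1)) ^ 2) q i.castSucc =
      rename Fin.castSucc G + E * X (Fin.last n) ^ 2 := by
    rw [localEquation, map_add, map_mul, map_pow, ← localEquation, ← localEquation, ← hE, aeval_X]
    congr 1
    · rw [hG, localEquation, localEquation, aeval_rename, ← AlgHom.comp_apply]
      congr 1
      ext j : 1
      rw [aeval_X, AlgHom.comp_apply, aeval_X, Function.comp_apply]
      refine Fin.succAboveCases i ?_ (fun j => ?_) j
      · simp
      · rw [← Fin.castSucc_succAbove_castSucc, Fin.insertNth_apply_succAbove,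
          Fin.insertNth_apply_succAbove, Fin.castSucc_succAbove_castSucc]
        simp [hq, mul_div_mul_left _ _ ha]
    · have : (Fin.last (n + 1)) = i.castSucc.succAbove (Fin.last n) := by
        simp
      rw [this, Fin.insertNth_apply_succAbove, ← this]
      simp [hq]
  have hE0 : eval 0 E ≠ 0 := by
    have : eval 0 E = eval ((q.rep i.castSucc)⁻¹ • q.rep) D := by
      rw [hE, localEquation, ← coe_aeval_eq_eval, ← coe_aeval_eq_eval]
      change (aeval 0) (aeval _ D) = aeval _ D
      rw [← AlgHom.comp_apply]
      congr 1
      ext j : 1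
      rw [AlgHom.comp_apply, aeval_X, aeval_X]
      refine Fin.succAboveCases i.castSucc ?_ (fun j => ?_) j
      · simp [hqi0]
      · rw [Fin.insertNth_apply_succAbove]
        simp [div_eq_inv_mul]
    rw [this, eval_smul hD]
    exact mul_ne_zero (pow_ne_zero _ (inv_ne_zero hqi0)) hDq
  have hlast : Fin.last n ∉ Set.range (Fin.castSucc : Fin n → Fin (n + 1)) := by
    rintro ⟨j, hj⟩
    exact (Fin.castSucc_lt_last j).ne hj
  have hcs := Fin.castSucc_injective n
  refine ⟨i.castSucc, hqi0, ?_, ?_, ?_⟩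
  · rw [hloc]
    simpa using h0
  · intro b
    rw [hloc]
    refine Fin.lastCases ?_ (fun b => ?_) b
    · simp [pderiv_rename_of_notMem_range hlast]
    · simpa [pderiv_rename hcs] using h1 b
  -- The last row of the Hessian at the origin is `(0, …, 0, 2 E(0))`, and the remaining block is
  -- the Hessian of `G`.
  · rw [hloc, det_of_last_row_eq_zero]
    · refine mul_ne_zero ?_ ?_
      · simpa [pderiv_rename_of_notMem_range hlast, map_ofNat constantCoeff 2] using hE0
      · convert h2 using 2
        ext b c
        simp [pderiv_rename hcs]
    · intro c
      simp [pderiv_rename hcs, pderiv_rename_of_notMem_range hlast]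

end Extension
-- Singular points of the threefold
section Threefold

variable {k : Type*} [Field k] {α β γ δ : MvPolynomial (Fin 3) k}

theorem constantCoeff_of_isHomogeneous {σ : Type*} {f : MvPolynomial σ k} {d : ℕ}
    (hf : f.IsHomogeneous d) (hd : d ≠ 0) : constantCoeff f = 0 := by
  have := eval_smul hf 0 0
  rwa [zero_smul, zero_pow hd, zero_mul, eval_zero] at this

theorem isHomogeneous_threefoldEquation (hα : α.IsHomogeneous 2) (hβ : β.IsHomogeneous 3)
    (hγ : γ.IsHomogeneous 4) (hδ : δ.IsHomogeneous 2) :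
    (threefoldEquation α β γ δ).IsHomogeneous 4 :=
  (((hα.rename_isHomogeneous.mul (isHomogeneous_X_pow 3 2)).add
    (hβ.rename_isHomogeneous.mul (isHomogeneous_X k 3))).add hγ.rename_isHomogeneous).add
    (hδ.rename_isHomogeneous.mul (isHomogeneous_X_pow 4 2))

theorem threefoldEquation_eq :
    threefoldEquation α β γ δ = rename Fin.castSucc (rename ![0, 1, 2] α * X 3 ^ 2 +
      rename ![0, 1, 2] β * X 3 + rename ![0, 1, 2] γ : MvPolynomial (Fin 4) k) +
      rename ![0, 1, 2] δ * X (Fin.last 4) ^ 2 := by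
  have h : (Fin.castSucc ∘ ![0, 1, 2] : Fin 3 → Fin 5) = ![0, 1, 2] := by decide
  simp only [threefoldEquation, map_add, map_mul, map_pow, rename_rename, h, rename_X]
  rfl

theorem singular_threefoldEquation_iff (w : Fin 5 → k) (u : Fin 3 → k) (hu : w ∘ ![0, 1, 2] = u) :
    (eval w (threefoldEquation α β γ δ) = 0 ∧
      ∀ i, eval w (pderiv i (threefoldEquation α β γ δ)) = 0) ↔
    eval u α * w 3 ^ 2 + eval u β * w 3 + eval u γ + eval u δ * w 4 ^ 2 = 0 ∧
    (∀ i, eval u (pderiv i α) * w 3 ^ 2 + eval u (pderiv i β) * w 3 + eval u (pderiv i γ) +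
      eval u (pderiv i δ) * w 4 ^ 2 = 0) ∧
    2 * eval u α * w 3 + eval u β = 0 ∧ 2 * eval u δ * w 4 = 0 := by
  have hinj : Function.Injective (![0, 1, 2] : Fin 3 → Fin 5) := by decide
  have h3 : (3 : Fin 5) ∉ Set.range (![0, 1, 2] : Fin 3 → Fin 5) := by
    rintro ⟨i, hi⟩; revert i; decide
  have h4 : (4 : Fin 5) ∉ Set.range (![0, 1, 2] : Fin 3 → Fin 5) := by
    rintro ⟨i, hi⟩; revert i; decide
  have hi3 : ∀ i : Fin 3, (3 : Fin 5) ≠ (![0, 1, 2] : Fin 3 → Fin 5) i := by decide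
  have hi4 : ∀ i : Fin 3, (4 : Fin 5) ≠ (![0, 1, 2] : Fin 3 → Fin 5) i := by decide
  have e0 : eval w (threefoldEquation α β γ δ) =
      eval u α * w 3 ^ 2 + eval u β * w 3 + eval u γ + eval u δ * w 4 ^ 2 := by
    simp [threefoldEquation, eval_rename, hu]
  have e1 : ∀ i : Fin 3, eval w (pderiv ((![0, 1, 2] : Fin 3 → Fin 5) i)
      (threefoldEquation α β γ δ)) = eval u (pderiv i α) * w 3 ^ 2 + eval u (pderiv i β) * w 3 +
        eval u (pderiv i γ) + eval u (pderiv i δ) * w 4 ^ 2 := by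
    intro i
    simp only [threefoldEquation, map_add, pderiv_mul, pderiv_pow, pderiv_rename hinj, map_mul,
      map_pow, eval_X, eval_rename, hu, pderiv_X_of_ne (hi3 i), pderiv_X_of_ne (hi4 i), map_zero]
    ring
  have e3 : eval w (pderiv 3 (threefoldEquation α β γ δ)) = 2 * eval u α * w 3 + eval u β := by
    simp only [threefoldEquation, map_add, pderiv_mul, pderiv_pow,
      pderiv_rename_of_notMem_range h3, map_mul, map_natCast,
      map_pow, eval_X, eval_rename, hu, pderiv_X_self, map_one, map_zero,
      pderiv_X_of_ne (show (4 : Fin 5) ≠ 3 by decide)]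
    push_cast
    ring
  have e4 : eval w (pderiv 4 (threefoldEquation α β γ δ)) = 2 * eval u δ * w 4 := by
    simp only [threefoldEquation, map_add, pderiv_mul, pderiv_pow,
      pderiv_rename_of_notMem_range h4, map_mul, map_natCast,
      map_pow, eval_X, eval_rename, hu, pderiv_X_self, map_one, map_zero,
      pderiv_X_of_ne (show (3 : Fin 5) ≠ 4 by decide)]
    push_cast
    ring
  rw [e0]
  refine and_congr_right fun _ => ⟨fun h => ⟨fun i => ?_, ?_, ?_⟩, fun ⟨h, h', h''⟩ i => ?_⟩
  · rw [← e1]; exact h _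
  · rw [← e3]; exact h _
  · rw [← e4]; exact h _
  · fin_cases i
    · exact (e1 0).trans (h 0)
    · exact (e1 1).trans (h 1)
    · exact (e1 2).trans (h 2)
    · exact e3.trans h'
    · exact e4.trans h''

/-- The term with the squared variable vanishes on the hyperplane together with all its first
partial derivatives, whatever `D` is. -/
theorem singular_extendZero_iff {n : ℕ} (F : MvPolynomial (Fin n) k)
    (D : MvPolynomial (Fin (n + 1)) k) (v : Fin n → k) :
    (eval (extendZero k n v) (rename Fin.castSucc F + D * X (Fin.last n) ^ 2) = 0 ∧
      ∀ i, eval (extendZero k n v)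
        (pderiv i (rename Fin.castSucc F + D * X (Fin.last n) ^ 2)) = 0) ↔
    eval v F = 0 ∧ ∀ i, eval v (pderiv i F) = 0 := by
  have hlast : Fin.last n ∉ Set.range (Fin.castSucc : Fin n → Fin (n + 1)) := by
    rintro ⟨j, hj⟩
    exact (Fin.castSucc_lt_last j).ne hj
  rw [Fin.forall_fin_succ']
  simp [pderiv_rename (Fin.castSucc_injective n), pderiv_rename_of_notMem_range hlast,
    eval_rename, extendZero_comp_castSucc]

/-- All four coefficient forms have degree at least two, so they and their first partial derivatives
vanish at the origin, to which every point of `L` projects. -/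
theorem lineL_subset_singularLocus (hα : α.IsHomogeneous 2) (hβ : β.IsHomogeneous 3)
    (hγ : γ.IsHomogeneous 4) (hδ : δ.IsHomogeneous 2) :
    lineL k ⊆ singularLocus (threefoldEquation α β γ δ) := by
  rintro p ⟨h0, h1, h2⟩
  have hu : p.rep ∘ ![0, 1, 2] = 0 := by
    ext i
    fin_cases i <;> assumption
  rw [mem_singularLocus, singular_threefoldEquation_iff p.rep 0 hu]
  simp [constantCoeff_of_isHomogeneous hα, constantCoeff_of_isHomogeneous hβ,
    constantCoeff_of_isHomogeneous hγ, constantCoeff_of_isHomogeneous hδ,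
    constantCoeff_of_isHomogeneous hα.pderiv, constantCoeff_of_isHomogeneous hβ.pderiv,
    constantCoeff_of_isHomogeneous hγ.pderiv, constantCoeff_of_isHomogeneous hδ.pderiv]

/-- Singular points of the threefold outside `L` lie in the hyperplane `z₄ = 0`, and `δ` does not
vanish there. -/
theorem singular_off_lineL [CharZero k] {ε₁ ε₂ : MvPolynomial (Fin 3) k}
    (hε₁ : ε₁.IsHomogeneous 3) (hε₂ : ε₂.IsHomogeneous 3)
    (hdisc : β ^ 2 - 4 * α * γ = ε₁ * ε₂) (hδ : IsGeneralConic α ε₁ ε₂ δ)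
    {q : ℙ k (Fin 5 → k)} (hq : q ∈ singularLocus (threefoldEquation α β γ δ))
    (hqL : q ∉ lineL k) : eval (q.rep ∘ ![0, 1, 2]) δ ≠ 0 ∧ q.rep 4 = 0 := by
  have hu : q.rep ∘ ![0, 1, 2] ≠ 0 := fun h =>
    hqL ⟨congrFun h 0, congrFun h 1, congrFun h 2⟩
  obtain ⟨h0, h1, h3, h4⟩ := (singular_threefoldEquation_iff q.rep _ rfl).1 (mem_singularLocus.1 hq)
  have h4' : eval (q.rep ∘ ![0, 1, 2]) δ * q.rep 4 = 0 := by simpa [mul_assoc] using h4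
  have hδu : eval (q.rep ∘ ![0, 1, 2]) δ ≠ 0 := by
    refine eval_delta_ne_zero hε₁ hε₂ hdisc hδ hu (z := q.rep 3) (c := q.rep 4 ^ 2) ?_ h3
      fun i => ?_
    -- Since `δ z₄ = 0`, the term `δ z₄²` drops out of the equation.
    · linear_combination h0 - q.rep 4 * h4'
    · linear_combination h1 i
  exact ⟨hδu, (mul_eq_zero.1 h4').resolve_left hδu⟩

end Threefold

/-! ### The hyperplane section `z₄ = 0` -/

section Hyperplane

variable {k : Type*} [Field k]

/-- The inclusion of the hyperplane at which the last coordinate vanishes. -/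
def hyperplaneMap (k : Type*) [Field k] (n : ℕ) : ℙ k (Fin n → k) → ℙ k (Fin (n + 1) → k) :=
  Projectivization.map (extendZero k n) extendZero_injective

theorem hyperplaneMap_injective (n : ℕ) : Function.Injective (hyperplaneMap k n) :=
  Projectivization.map_injective _ _

theorem extendZero_ne_zero {n : ℕ} {v : Fin n → k} (hv : v ≠ 0) : extendZero k n v ≠ 0 :=
  (map_ne_zero_iff _ extendZero_injective).2 hv

theorem hyperplaneMap_eq_mk {n : ℕ} (p : ℙ k (Fin n → k)) :
    hyperplaneMap k n p =
      Projectivization.mk k (extendZero k n p.rep) (extendZero_ne_zero p.rep_nonzero) := by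
  conv_lhs => rw [← p.mk_rep]
  rfl

theorem exists_rep_hyperplaneMap {n : ℕ} (p : ℙ k (Fin n → k)) :
    ∃ a : k, a ≠ 0 ∧ (hyperplaneMap k n p).rep = a • extendZero k n p.rep := by
  rw [hyperplaneMap_eq_mk]
  obtain ⟨a, ha⟩ := Projectivization.exists_smul_eq_mk_rep k _ (extendZero_ne_zero p.rep_nonzero)
  exact ⟨a, a.ne_zero, ha.symm⟩

theorem exists_hyperplaneMap_eq {n : ℕ} {q : ℙ k (Fin (n + 1) → k)} (hq : q.rep (Fin.last n) = 0) :
    ∃ p, hyperplaneMap k n p = q := by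
  have h : extendZero k n (q.rep ∘ Fin.castSucc) = q.rep := by
    ext i
    refine Fin.lastCases ?_ (fun j => ?_) i <;> simp [hq]
  have hv : q.rep ∘ Fin.castSucc ≠ 0 := fun h0 => q.rep_nonzero (by rw [← h, h0, map_zero])
  refine ⟨Projectivization.mk k _ hv, ?_⟩
  conv_rhs => rw [← q.mk_rep]
  rw [hyperplaneMap, Projectivization.map_mk]
  congr 1

theorem hyperplaneMap_mem_singularLocus {n d : ℕ} {F : MvPolynomial (Fin (n + 1)) k}
    {D : MvPolynomial (Fin (n + 2)) k}
    (hh : (rename Fin.castSucc F + D * X (Fin.last (n + 1)) ^ 2).IsHomogeneous d)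
    (p : ℙ k (Fin (n + 1) → k)) :
    hyperplaneMap k (n + 1) p ∈ singularLocus (rename Fin.castSucc F + D * X (Fin.last (n + 1)) ^ 2)
      ↔ p ∈ singularLocus F := by
  rw [hyperplaneMap_eq_mk, mk_mem_singularLocus hh, singular_extendZero_iff, mem_singularLocus]

/-- The point `(0:0:0:1)`. -/
def vertex (k : Type*) [Field k] : ℙ k (Fin 4 → k) :=
  Projectivization.mk k (Pi.single 3 1) (by simp)

/-- This is why exactly one of the ten nodes is absorbed by `L`. -/
theorem hyperplaneMap_mem_lineL {p : ℙ k (Fin 4 → k)} :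
    hyperplaneMap k 4 p ∈ lineL k ↔ p = vertex k := by
  have key : hyperplaneMap k 4 p ∈ lineL k ↔ p.rep 0 = 0 ∧ p.rep 1 = 0 ∧ p.rep 2 = 0 := by
    obtain ⟨a, ha, h⟩ := exists_rep_hyperplaneMap p
    have e : ∀ i : Fin 4, (hyperplaneMap k 4 p).rep i.castSucc = 0 ↔ p.rep i = 0 := by
      simp [h, ha]
    exact and_congr (e 0) (and_congr (e 1) (e 2))
  rw [key]
  constructor
  · rintro ⟨h0, h1, h2⟩
    rw [← p.mk_rep, vertex, Projectivization.mk_eq_mk_iff']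
    refine ⟨p.rep 3, ?_⟩
    ext i
    fin_cases i <;> simp [h0, h1, h2]
  · rintro rfl
    obtain ⟨a, ha, h⟩ := exists_rep_mk (k := k) (n := 3) (v := Pi.single 3 1) (by simp)
    simp [vertex, h]

/-- An isolated singular point `p` of `V(F)` with `p i ≠ 0` is an isolated singular point of
`V(F + D X²)`, `X` a new variable, if all singular points `q` of the latter with `q i ≠ 0` lie in
the hyperplane `X = 0`. -/
theorem IsIsolatedSingularity.extend {n d : ℕ} {F : MvPolynomial (Fin (n + 1)) k}
    {D : MvPolynomial (Fin (n + 2)) k}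
    (hh : (rename Fin.castSucc F + D * X (Fin.last (n + 1)) ^ 2).IsHomogeneous d)
    {p : ℙ k (Fin (n + 1) → k)} (hp : IsIsolatedSingularity F p) (i : Fin (n + 1))
    (hi : p.rep i ≠ 0)
    (hsing : ∀ q ∈ singularLocus (rename Fin.castSucc F + D * X (Fin.last (n + 1)) ^ 2),
      q.rep i.castSucc ≠ 0 → q.rep (Fin.last (n + 1)) = 0) :
    IsIsolatedSingularity (rename Fin.castSucc F + D * X (Fin.last (n + 1)) ^ 2)
      (hyperplaneMap k (n + 1) p) := by
  obtain ⟨hps, e, g, hg, hgp, hiso⟩ := hp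
  -- The extra factor `X i.castSucc` confines the neighbourhood to the chart where `hsing` applies.
  have hg' : (rename Fin.castSucc g * X i.castSucc : MvPolynomial (Fin (n + 2)) k).IsHomogeneous
    (e + 1) := hg.rename_isHomogeneous.mul (isHomogeneous_X k _)
  refine ⟨(hyperplaneMap_mem_singularLocus hh p).2 hps, e + 1, _, hg', ?_, fun q hq hqg => ?_⟩
  · rw [hyperplaneMap_eq_mk, mk_mem_zeroLocus hg']
    have : eval p.rep g ≠ 0 := hgp
    simp [eval_rename, extendZero_comp_castSucc, this, hi]
  · have hqg' : eval (q.rep ∘ Fin.castSucc) g ≠ 0 ∧ q.rep i.castSucc ≠ 0 := by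
      have : eval q.rep (rename Fin.castSucc g * X i.castSucc) ≠ 0 := hqg
      simpa [eval_rename] using this
    obtain ⟨p', rfl⟩ := exists_hyperplaneMap_eq (hsing q hq hqg'.2)
    rw [hiso p' ((hyperplaneMap_mem_singularLocus hh p').1 hq) fun h => ?_]
    refine hqg ?_
    rw [hyperplaneMap_eq_mk, mk_mem_zeroLocus hg']
    have : eval p'.rep g = 0 := h
    simp [eval_rename, extendZero_comp_castSucc, this]

end Hyperplane

end QuarticThreefold

open QuarticThreefold in
theorem proposition5 {k : Type*} [Field k] [IsAlgClosed k] [CharZero k]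
    (l : Matrix (Fin 4) (Fin 4) (MvPolynomial (Fin 4) k))
    (α β γ ε₁ ε₂ δ : MvPolynomial (Fin 3) k)
    (hl : QuarticThreefold.IsGeneralSymmetroid l α β γ ε₁ ε₂)
    (hδ : QuarticThreefold.IsGeneralConic α ε₁ ε₂ δ) :
    (QuarticThreefold.lineL k ⊆
      QuarticThreefold.singularLocus (QuarticThreefold.threefoldEquation α β γ δ)) ∧
    ∃ N : Finset (ℙ k (Fin 5 → k)), N.card = 9 ∧
      (∀ p ∈ N, p ∉ QuarticThreefold.lineL k ∧
        QuarticThreefold.IsIsolatedSingularity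
          (QuarticThreefold.threefoldEquation α β γ δ) p ∧
        QuarticThreefold.IsNode (QuarticThreefold.threefoldEquation α β γ δ) p) ∧
      ∀ p ∈ QuarticThreefold.singularLocus (QuarticThreefold.threefoldEquation α β γ δ),
        p ∈ QuarticThreefold.lineL k ∨ p ∈ N := by
  have hLsub := lineL_subset_singularLocus hl.homogeneous_α hl.homogeneous_β hl.homogeneous_γ
    hδ.homogeneous
  refine ⟨hLsub, ?_⟩
  have hoff := fun q => singular_off_lineL (q := q) hl.homogeneous_ε₁ hl.homogeneous_ε₂
    hl.discriminant hδ
  have hhom := isHomogeneous_threefoldEquation hl.homogeneous_α hl.homogeneous_β hl.homogeneous_γ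
    hδ.homogeneous
  have heq : threefoldEquation α β γ δ =
      rename Fin.castSucc l.det + rename ![0, 1, 2] δ * X (Fin.last 4) ^ 2 := by
    rw [hl.det_eq, threefoldEquation_eq]
  rw [heq] at hLsub hoff hhom ⊢
  have hmem := hyperplaneMap_mem_singularLocus hhom
  have hfin : (singularLocus l.det).Finite :=
    Set.finite_of_ncard_ne_zero (by rw [hl.ten_singular]; norm_num)
  -- The vertex is singular on the symmetroid because its image lies on `L`, where the threefold is
  -- singular.
  have hvertex : vertex k ∈ singularLocus l.det :=
    (hmem _).1 (hLsub (hyperplaneMap_mem_lineL.2 rfl))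
  have hfin' : (singularLocus l.det \ {vertex k}).Finite := hfin.sdiff
  refine ⟨hfin'.toFinset.map ⟨hyperplaneMap k 4, hyperplaneMap_injective 4⟩, ?_, ?_, ?_⟩
  · rw [Finset.card_map, ← Set.ncard_eq_toFinset_card _ hfin',
      Set.ncard_sdiff_singleton_of_mem hvertex, hl.ten_singular]
  · intro q hq
    obtain ⟨p, hp, rfl⟩ := Finset.mem_map.1 hq
    obtain ⟨hps, hpv⟩ := hfin'.mem_toFinset.1 hp
    have hqL : hyperplaneMap k 4 p ∉ lineL k := fun h => hpv (hyperplaneMap_mem_lineL.1 h)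
    obtain ⟨hδp, -⟩ := hoff _ ((hmem p).2 hps) hqL
    obtain ⟨a, ha, hrep⟩ := exists_rep_hyperplaneMap p
    obtain ⟨hiso, hnode⟩ := hl.nodes p hps
    refine ⟨hqL, ?_, hnode.extend hδ.homogeneous.rename_isHomogeneous ha hrep ?_⟩
    -- A coordinate vanishing on `L` but not at `p`, one of the first three: the chart `z_j ≠ 0`
    -- then misses `L`, as isolation requires.
    · obtain ⟨j, hjL, hj⟩ : ∃ j : Fin 4,
          (∀ q : ℙ k (Fin 5 → k), q ∈ lineL k → q.rep j.castSucc = 0) ∧ p.rep j ≠ 0 := by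
        by_contra! hcon
        have e : ∀ j : Fin 4, p.rep j = 0 → (hyperplaneMap k 4 p).rep j.castSucc = 0 := by
          intro j hj
          simp [hrep, hj]
        exact hqL ⟨e 0 (hcon 0 fun q hq => hq.1), e 1 (hcon 1 fun q hq => hq.2.1),
          e 2 (hcon 2 fun q hq => hq.2.2)⟩
      exact hiso.extend hhom j hj fun q hq hqj => (hoff q hq fun h => hqj (hjL q h)).2
    · rwa [eval_rename]
  · intro q hq
    by_cases hqL : q ∈ lineL k
    · exact Or.inl hqL
    · obtain ⟨p, rfl⟩ := exists_hyperplaneMap_eq (n := 4) (hoff q hq hqL).2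
      refine Or.inr (Finset.mem_map.2 ⟨p, hfin'.mem_toFinset.2 ⟨(hmem p).1 hq, ?_⟩, rfl⟩)
      exact fun h => hqL (hyperplaneMap_mem_lineL.2 h)
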